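/- Let $(x_i,y_i)_{i=1}^n$, $n\ge 1$, be a binary training set with $x_i\in\mathbb{R}^d$ and labels $y_i\in\{-1,+1\}$ (the classes $0$ and $1$), linearly separable in the sense that some $\theta$ satisfies $y_i\theta^\top x_i>0$ for all $i$, and consider the linear model $f_\theta(x)=\theta^\top x$. Let $l_\pm\in\mathbb{R}$, $\Delta_\pm>0$, $w_\pm>0$ be arbitrary, and let the binary parametric loss be $$\ell(y,f_\theta(x))=w_y\log\big(1+e^{l_y}e^{-\Delta_y\,y f_\theta(x)}\big).$$ For an objective $L:\mathbb{R}^d\to\mathbb{R}$ let $\theta_R$ be the minimizer of $L(\theta)$ subject to $\|\theta\|_2\le R$, and call $\theta_\infty=\lim_{R\to\infty}\theta_R/R$ the (normalized) ridgeless minimizer of $L$; it is well defined if for every $R>0$ the minimizer exists and is unique, and the limit exists. Then there exist augmentation radii $\varepsilon_+>0$ and $\varepsilon_->0$ for the two classes such that the ridgeless minimizer of the parametric training loss $$\sum_{i=1}^n \ell(y_i,f_\theta(x_i))$$ and the ridgeless minimizer of the logistic training loss under personalized spherical augmentation $$\sum_{i=1}^n \mathbb{E}_{z\sim\mathrm{Unif}(B(x_i,\varepsilon_{y_i}))}\Big[\log\big(1+e^{-y_i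 f_\theta(z)}\big)\Big],$$ where $B(x,r)$ is the closed $\ell_2$-ball of radius $r$ around $x$, are both well defined, have unit norm, and are equal. -/

import Mathlib

open scoped RealInnerProductSpace ProbabilityTheory

noncomputable section

/-- The signed encoding of the two class labels: class `0` is the negative class `-1` and
class `1` is the positive class `+1`. -/
def labelSign (c : Fin 2) : ℝ := if c = 1 then 1 else -1

/-- The prediction `f_θ(x) = θᵀ x` of the linear model. -/
def linearModel {d : ℕ} (θ x : EuclideanSpace ℝ (Fin d)) : ℝ := ⟪θ, x⟫

/-- Linear separability of a labelled dataset (by the linear model, strictly). -/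
def LinearlySeparable {d n : ℕ} (x : Fin n → EuclideanSpace ℝ (Fin d)) (y : Fin n → Fin 2) :
    Prop :=
  ∃ θ : EuclideanSpace ℝ (Fin d), ∀ i, 0 < labelSign (y i) * linearModel θ (x i)

/-- The binary parametric loss `w_y log (1 + e^{l_y} e^{-Δ_y y f})` of a prediction `f`
for an example of class `c`. -/
def parametricLoss (w l Δ : Fin 2 → ℝ) (c : Fin 2) (f : ℝ) : ℝ :=
  w c * Real.log (1 + Real.exp (l c) * Real.exp (-(Δ c * labelSign c * f)))

/-- The standard logistic loss `log (1 + e^{-y f})`. -/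
def logisticLoss (c : Fin 2) (f : ℝ) : ℝ :=
  Real.log (1 + Real.exp (-(labelSign c * f)))

/-- The training objective of the parametric loss. -/
def parametricRisk {d n : ℕ} (x : Fin n → EuclideanSpace ℝ (Fin d)) (y : Fin n → Fin 2)
    (w l Δ : Fin 2 → ℝ) (θ : EuclideanSpace ℝ (Fin d)) : ℝ :=
  ∑ i, parametricLoss w l Δ (y i) (linearModel θ (x i))

/-- Spherical augmentation of `x` with radius `r > 0`: the law of a point sampled uniformly
from the closed `ℓ²`-ball of radius `r` around `x`. -/
def sphericalAugmentation {d : ℕ} (x : EuclideanSpace ℝ (Fin d)) (r : ℝ) :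
    MeasureTheory.Measure (EuclideanSpace ℝ (Fin d)) :=
  ProbabilityTheory.cond MeasureTheory.volume (Metric.closedBall x r)

/-- The training objective of the logistic loss under personalized augmentation: an example of
class `c` is augmented spherically with the radius `ε c` of its class. -/
def augmentedLogisticRisk {d n : ℕ} (x : Fin n → EuclideanSpace ℝ (Fin d)) (y : Fin n → Fin 2)
    (ε : Fin 2 → ℝ) (θ : EuclideanSpace ℝ (Fin d)) : ℝ :=
  ∑ i, ∫ z, logisticLoss (y i) (linearModel θ z) ∂(sphericalAugmentation (x i) (ε (y i)))

/-- `θ` solves the ridge-constrained problem: minimize `L θ` subject to `‖θ‖₂ ≤ R`. -/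
def IsRidgeSolution {d : ℕ} (L : EuclideanSpace ℝ (Fin d) → ℝ) (R : ℝ)
    (θ : EuclideanSpace ℝ (Fin d)) : Prop :=
  ‖θ‖ ≤ R ∧ ∀ θ' : EuclideanSpace ℝ (Fin d), ‖θ'‖ ≤ R → L θ ≤ L θ'

/-- `u` is the normalized ridgeless minimizer of `L`: for every `R > 0` the ridge-constrained
problem has exactly one solution `θ_R`, and `θ_R / R → u` as `R → ∞`. -/
def IsRidgelessSolution {d : ℕ} (L : EuclideanSpace ℝ (Fin d) → ℝ)
    (u : EuclideanSpace ℝ (Fin d)) : Prop :=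
  ∃ θ : ℝ → EuclideanSpace ℝ (Fin d),
    (∀ R : ℝ, 0 < R → IsRidgeSolution L R (θ R) ∧ ∀ θ', IsRidgeSolution L R θ' → θ' = θ R) ∧
    Filter.Tendsto (fun R : ℝ => R⁻¹ • θ R) Filter.atTop (nhds u)

end

open Filter Topology Metric MeasureTheory

/-! Both ridgeless minimizers are maximum margin directions. On the sphere of radius `R`, each
objective decays like `exp (-R * m)` up to subexponential factors. For the parametric loss, `m` is
the least of `Δ_y * y⟪u, x⟫`: the offsets `l` and weights `w` only change constants. For the
augmented loss, the worst points of the ball dominate, so `m` is the least of `y⟪u, x⟫ - ε_y` (`‖u‖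
= 1`).

Let `γ` be the optimal value of the first margin problem and put `ε_c = γ / Δ_c - t` with small `t >
0`. Then `y⟪u, x⟫ - ε_y ≥ t` says exactly `Δ_y * y⟪u, x⟫ ≥ γ`, so both problems single out the same
unit vector. `exists_unique_max_margin` supplies this vector, and
`isRidgelessSolution_of_exponential_bounds` turns the decay estimates into convergence of the
normalized minimizers. -/

/-- The softplus function `a ↦ log (1 + e^a)`. -/
noncomputable def softplus (a : ℝ) : ℝ := Real.log (1 + Real.exp a)

theorem softplus_nonneg (a : ℝ) : 0 ≤ softplus a :=
  Real.log_nonneg (by linarith [Real.exp_pos a])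

theorem softplus_strictMono : StrictMono softplus := by
  intro a b hab
  have := Real.exp_lt_exp.2 hab
  exact Real.log_lt_log (by positivity) (by linarith)

theorem softplus_le_exp (a : ℝ) : softplus a ≤ Real.exp a := by
  have := Real.log_le_sub_one_of_pos (show 0 < 1 + Real.exp a by positivity)
  unfold softplus
  linarith

theorem half_exp_le_softplus {a : ℝ} (ha : a ≤ 0) : Real.exp a / 2 ≤ softplus a := by
  have h1 : Real.exp a ≤ 1 := Real.exp_le_one_iff.2 ha
  have h0 := Real.exp_pos a
  have h := Real.one_sub_inv_le_log_of_pos (show 0 < 1 + Real.exp a by positivity)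
  refine le_trans ?_ h
  rw [show 1 - (1 + Real.exp a)⁻¹ = Real.exp a / (1 + Real.exp a) by field_simp; ring]
  gcongr
  linarith

theorem hasDerivAt_softplus (a : ℝ) :
    HasDerivAt softplus (Real.exp a / (1 + Real.exp a)) a :=
  ((Real.hasDerivAt_exp a).const_add 1).log (by positivity)

theorem continuous_softplus : Continuous softplus :=
  continuous_iff_continuousAt.2 fun a => (hasDerivAt_softplus a).continuousAt

theorem convexOn_softplus : ConvexOn ℝ Set.univ softplus := by
  refine Monotone.convexOn_univ_of_deriv
    (fun a => (hasDerivAt_softplus a).differentiableAt) fun a b hab => ?_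
  rw [(hasDerivAt_softplus a).deriv, (hasDerivAt_softplus b).deriv,
    div_le_div_iff₀ (by positivity) (by positivity)]
  have := Real.exp_le_exp.2 hab
  linarith

theorem labelSign_mul_self (c : Fin 2) : labelSign c * labelSign c = 1 := by
  unfold labelSign
  split_ifs <;> norm_num

theorem abs_labelSign (c : Fin 2) : |labelSign c| = 1 := by
  unfold labelSign
  split_ifs <;> norm_num

theorem logisticLoss_eq_softplus (c : Fin 2) (f : ℝ) :
    logisticLoss c f = softplus (-(labelSign c * f)) := rfl

theorem parametricLoss_eq_softplus (w l Δ : Fin 2 → ℝ) (c : Fin 2) (f : ℝ) :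
    parametricLoss w l Δ c f = w c * softplus (l c - Δ c * (labelSign c * f)) := by
  rw [parametricLoss, softplus, ← Real.exp_add]
  congr 4
  ring

theorem linearModel_smul {d : ℕ} (a : ℝ) (θ x : EuclideanSpace ℝ (Fin d)) :
    linearModel (a • θ) x = a * linearModel θ x := by
  simp [linearModel, real_inner_smul_left]

theorem linearModel_add {d : ℕ} (θ θ' x : EuclideanSpace ℝ (Fin d)) :
    linearModel (θ + θ') x = linearModel θ x + linearModel θ' x := by
  simp [linearModel, inner_add_left]

theorem continuous_linearModel_left {d : ℕ} (x : EuclideanSpace ℝ (Fin d)) :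
    Continuous fun θ => linearModel θ x := by
  unfold linearModel
  fun_prop

theorem continuous_linearModel_right {d : ℕ} (θ : EuclideanSpace ℝ (Fin d)) :
    Continuous fun x => linearModel θ x := by
  unfold linearModel
  fun_prop

/-- The softplus of an affine function of the prediction is convex in the parameter. -/
theorem convexOn_softplus_linearModel {d : ℕ} (a b : ℝ) (x : EuclideanSpace ℝ (Fin d)) :
    ConvexOn ℝ Set.univ fun θ => softplus (b - a * linearModel θ x) := by
  refine ⟨convex_univ, fun θ _ θ' _ p q hp hq hpq => ?_⟩
  have h := convexOn_softplus.2 (Set.mem_univ (b - a * linearModel θ x))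
    (Set.mem_univ (b - a * linearModel θ' x)) hp hq hpq
  have e : b - a * linearModel (p • θ + q • θ') x =
      p • (b - a * linearModel θ x) + q • (b - a * linearModel θ' x) := by
    rw [linearModel_add, linearModel_smul, linearModel_smul, smul_eq_mul, smul_eq_mul]
    linear_combination (-b) * hpq
  simp only [e]
  exact h

/-! ### Margin maximization and ridgeless limits -/

/-- The normalized maximum margin direction for the scaled margins `a i * ⟪u, x i⟫`: it is the
only point of the unit ball that attains the optimal margin `γ > 0`. -/
theorem exists_unique_max_margin {d n : ℕ} (hn : 0 < n)
    (x : Fin n → EuclideanSpace ℝ (Fin d)) (a : Fin n → ℝ)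
    (hsep : ∃ θ, ∀ i, 0 < a i * linearModel θ (x i)) :
    ∃ u : EuclideanSpace ℝ (Fin d), ∃ γ : ℝ, ‖u‖ = 1 ∧ 0 < γ ∧
      (∀ i, γ ≤ a i * linearModel u (x i)) ∧
      ∀ v, ‖v‖ ≤ 1 → (∀ i, γ ≤ a i * linearModel v (x i)) → v = u := by
  have hne : (Finset.univ : Finset (Fin n)).Nonempty := ⟨⟨0, hn⟩, Finset.mem_univ _⟩
  set G : EuclideanSpace ℝ (Fin d) → ℝ :=
    fun v => Finset.univ.inf' hne fun i => a i * linearModel v (x i) with hG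
  have hGc : Continuous G :=
    Continuous.finset_inf'_apply hne fun i _ =>
      continuous_const.mul (continuous_linearModel_left (x i))
  have hGle : ∀ (v : EuclideanSpace ℝ (Fin d)) (t : ℝ),
      t ≤ G v ↔ ∀ i, t ≤ a i * linearModel v (x i) := by
    intro v t
    simp [hG, Finset.le_inf'_iff]
  have hscale : ∀ (v : EuclideanSpace ℝ (Fin d)) (r : ℝ), 0 ≤ r → r * G v ≤ G (r • v) := by
    intro v r hr
    rw [hGle]
    intro i
    have := mul_le_mul_of_nonneg_left ((hGle v (G v)).1 le_rfl i) hr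
    rw [linearModel_smul]
    linarith
  obtain ⟨u, hu, humax⟩ := (isCompact_closedBall (0 : EuclideanSpace ℝ (Fin d)) 1).exists_isMaxOn
    ⟨0, by simp⟩ hGc.continuousOn
  have hmax : ∀ v, ‖v‖ ≤ 1 → G v ≤ G u := fun v hv => humax (by simpa using hv)
  have hpos : 0 < G u := by
    obtain ⟨θ, hθ⟩ := hsep
    have h1 : 0 < G θ := by
      rw [hG, Finset.lt_inf'_iff]
      exact fun i _ => hθ i
    have hθ0 : 0 < ‖θ‖ := by
      rw [norm_pos_iff]
      rintro rfl
      have := hθ ⟨0, hn⟩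
      simp [linearModel] at this
    calc 0 < ‖θ‖⁻¹ * G θ := by positivity
      _ ≤ G (‖θ‖⁻¹ • θ) := hscale _ _ (by positivity)
      _ ≤ G u := hmax _ (by
        rw [norm_smul, norm_inv, norm_norm, inv_mul_cancel₀ hθ0.ne'])
  -- An optimal point inside the open ball could be rescaled to norm one, strictly increasing its
  -- positive margin.
  have hnorm : ∀ v, ‖v‖ ≤ 1 → G u ≤ G v → ‖v‖ = 1 := by
    intro v hv hGv
    have hv0 : 0 < ‖v‖ := by
      rw [norm_pos_iff]
      rintro rfl
      have := (hGle 0 (G u)).1 hGv ⟨0, hn⟩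
      simp [linearModel] at this
      linarith
    have h := (hscale v ‖v‖⁻¹ (by positivity)).trans
      (hmax (‖v‖⁻¹ • v) (by rw [norm_smul, norm_inv, norm_norm, inv_mul_cancel₀ hv0.ne']))
    rw [inv_mul_le_iff₀ hv0] at h
    refine le_antisymm hv ?_
    by_contra! hlt
    nlinarith
  refine ⟨u, G u, hnorm u (by simpa using hu) le_rfl, hpos, (hGle u (G u)).1 le_rfl,
    fun v hv hvG => ?_⟩
  -- The midpoint of two distinct optimal points is still optimal, but strict convexity of the norm
  -- puts it inside the open ball.
  by_contra hne'
  have hu1 : ‖u‖ ≤ 1 := by simpa using hu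
  have hlt := norm_combo_lt_of_ne hv hu1 hne' (by norm_num : (0 : ℝ) < 1 / 2)
    (by norm_num : (0 : ℝ) < 1 / 2) (by norm_num)
  refine hlt.ne (hnorm _ hlt.le ((hGle _ _).2 fun i => ?_))
  have h1 := hvG i
  have h2 := (hGle u (G u)).1 le_rfl i
  rw [linearModel_add, linearModel_smul, linearModel_smul]
  linarith

/-- A convex objective that strictly decreases along a fixed direction has exactly one minimizer
on each centred ball, and that minimizer lies on the sphere. -/
theorem exists_unique_isRidgeSolution {d : ℕ} {L : EuclideanSpace ℝ (Fin d) → ℝ}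
    {u : EuclideanSpace ℝ (Fin d)} (hL : ConvexOn ℝ Set.univ L)
    (hdec : ∀ θ, ∀ τ : ℝ, 0 < τ → L (θ + τ • u) < L θ) {R : ℝ} (hR : 0 < R) :
    ∃ θ, IsRidgeSolution L R θ ∧ ‖θ‖ = R ∧ ∀ θ', IsRidgeSolution L R θ' → θ' = θ := by
  have hLc : Continuous L := continuousOn_univ.1 (hL.continuousOn isOpen_univ)
  have hbd : ∀ θ, IsRidgeSolution L R θ → ‖θ‖ = R := by
    intro θ hθ
    by_contra hne
    have hlt : ‖θ‖ < R := lt_of_le_of_ne hθ.1 hne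
    -- A step short enough to stay in the ball; the added `1` keeps the denominator positive even if
    -- `u = 0`.
    have hτ : 0 < (R - ‖θ‖) / (1 + ‖u‖) := div_pos (by linarith) (by positivity)
    refine (hdec θ _ hτ).not_ge (hθ.2 _ ?_)
    refine (norm_add_le _ _).trans ?_
    rw [norm_smul, Real.norm_of_nonneg hτ.le]
    have h1 : (R - ‖θ‖) / (1 + ‖u‖) * (1 + ‖u‖) = R - ‖θ‖ :=
      div_mul_cancel₀ _ (by positivity)
    linarith
  obtain ⟨θ, hθ, hmin⟩ := (isCompact_closedBall (0 : EuclideanSpace ℝ (Fin d)) R).exists_isMinOn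
    ⟨0, by simpa using hR.le⟩ hLc.continuousOn
  have hsol : IsRidgeSolution L R θ :=
    ⟨by simpa using hθ, fun θ' hθ' => hmin (by simpa using hθ')⟩
  refine ⟨θ, hsol, hbd θ hsol, fun θ' hθ' => ?_⟩
  by_contra hne
  have hlt := norm_combo_lt_of_ne hθ'.1 hsol.1 hne (by norm_num : (0 : ℝ) < 1 / 2)
    (by norm_num : (0 : ℝ) < 1 / 2) (by norm_num)
  refine hlt.ne (hbd _ ⟨hlt.le, fun v hv => ?_⟩)
  have h := hL.2 (Set.mem_univ θ') (Set.mem_univ θ) (by norm_num : (0 : ℝ) ≤ 1 / 2)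
    (by norm_num : (0 : ℝ) ≤ 1 / 2) (by norm_num)
  simp only [smul_eq_mul] at h
  linarith [hθ'.2 v hv, hsol.2 v hv]

/-- If the objective behaves on large spheres like `exp (-R * min_i g_i)` up to subexponential
factors, and `u` is the only point of the unit ball where all `g_i` are at least `γ`, then `u` is
the ridgeless solution. -/
theorem isRidgelessSolution_of_exponential_bounds {d n : ℕ}
    {L : EuclideanSpace ℝ (Fin d) → ℝ} {u : EuclideanSpace ℝ (Fin d)}
    (hu : ‖u‖ ≤ 1) (hL : ConvexOn ℝ Set.univ L)
    (hdec : ∀ θ, ∀ τ : ℝ, 0 < τ → L (θ + τ • u) < L θ)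
    {γ C : ℝ} (hγ : 0 < γ)
    (hupper : ∀ R : ℝ, 0 < R → L (R • u) ≤ C * Real.exp (-(R * γ)))
    (g : Fin n → EuclideanSpace ℝ (Fin d) → ℝ) (hg : ∀ i, Continuous (g i))
    (hunique : ∀ v, ‖v‖ ≤ 1 → (∀ i, γ ≤ g i v) → v = u)
    (hlower : ∀ i, ∀ δ : ℝ, 0 < δ → ∃ p : ℝ, 0 < p ∧ ∀ᶠ R : ℝ in atTop,
      ∀ v, ‖v‖ = 1 → p * softplus (-(R * (g i v + δ))) ≤ L (R • v)) :
    IsRidgelessSolution L u := by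
  choose! θ hsol hnorm huniq using
    fun (R : ℝ) (hR : 0 < R) => exists_unique_isRidgeSolution hL hdec hR
  refine ⟨θ, fun R hR => ⟨hsol R hR, huniq R hR⟩, ?_⟩
  have hunit : ∀ R : ℝ, 0 < R → ‖R⁻¹ • θ R‖ = 1 := by
    intro R hR
    rw [norm_smul, norm_inv, Real.norm_of_nonneg hR.le, hnorm R hR, inv_mul_cancel₀ hR.ne']
  have hgev : ∀ i, ∀ δ : ℝ, 0 < δ → δ < γ → ∀ᶠ R : ℝ in atTop, γ - 2 * δ ≤ g i (R⁻¹ • θ R) := by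
    intro i δ hδ hδγ
    obtain ⟨p, hp, hev⟩ := hlower i δ hδ
    have hexp : Tendsto (fun R : ℝ => Real.exp (R * δ)) atTop atTop :=
      Real.tendsto_exp_atTop.comp (tendsto_id.atTop_mul_const hδ)
    filter_upwards [hev, eventually_gt_atTop 0, hexp.eventually_gt_atTop (2 * C / p)]
      with R hRlow hR hRexp
    -- If the margin were below `γ - 2δ`, the loss at `θ R` would be at least of order `exp (-R(γ -
    -- δ))`, exceeding the bound `C * exp (-Rγ)` at the competitor `R • u`.
    by_contra! hlt
    have h1 := hRlow _ (hunit R hR)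
    rw [smul_inv_smul₀ hR.ne'] at h1
    have h2 : L (θ R) ≤ L (R • u) := (hsol R hR).2 _ (by
      rw [norm_smul, Real.norm_of_nonneg hR.le]
      nlinarith)
    have h3 : softplus (-(R * (γ - δ))) ≤ softplus (-(R * (g i (R⁻¹ • θ R) + δ))) :=
      softplus_strictMono.monotone (by nlinarith)
    have h4 : Real.exp (-(R * (γ - δ))) / 2 ≤ softplus (-(R * (γ - δ))) :=
      half_exp_le_softplus (by nlinarith)
    have h5 : p * (Real.exp (-(R * (γ - δ))) / 2) ≤ C * Real.exp (-(R * γ)) :=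
      (mul_le_mul_of_nonneg_left (h4.trans h3) hp.le).trans (h1.trans (h2.trans (hupper R hR)))
    rw [show -(R * (γ - δ)) = -(R * γ) + R * δ by ring, Real.exp_add] at h5
    rw [div_lt_iff₀ hp] at hRexp
    nlinarith [Real.exp_pos (-(R * γ))]
  -- By compactness it suffices that `u` is the only cluster point.
  refine (isCompact_closedBall (0 : EuclideanSpace ℝ (Fin d)) 1).tendsto_nhds_of_unique_mapClusterPt
    ?_ fun v hv hcl => ?_
  · filter_upwards [eventually_gt_atTop 0] with R hR
    simp [hunit R hR]
  · refine hunique v (by simpa using hv) fun i => ?_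
    have hle : ∀ δ : ℝ, 0 < δ → δ < γ → γ - 2 * δ ≤ g i v := by
      intro δ hδ hδγ
      have hclosed : IsClosed {v' | γ - 2 * δ ≤ g i v'} := isClosed_le continuous_const (hg i)
      exact hclosed.mem_of_mapClusterPt hcl (hgev i δ hδ hδγ)
    by_contra! hlt
    have := hle (min (γ / 2) ((γ - g i v) / 4))
      (lt_min (by linarith) (by linarith)) ((min_le_left _ _).trans_lt (by linarith))
    linarith [min_le_right (γ / 2) ((γ - g i v) / 4)]

theorem convexOn_univ_sum {d n : ℕ} {f : Fin n → EuclideanSpace ℝ (Fin d) → ℝ}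
    (hf : ∀ i, ConvexOn ℝ Set.univ (f i)) : ConvexOn ℝ Set.univ fun θ => ∑ i, f i θ := by
  refine ⟨convex_univ, fun θ _ θ' _ p q hp hq hpq => ?_⟩
  simp only [Finset.smul_sum, ← Finset.sum_add_distrib]
  exact Finset.sum_le_sum fun i _ => (hf i).2 (Set.mem_univ _) (Set.mem_univ _) hp hq hpq

/-! ### The parametric loss -/

theorem isRidgelessSolution_parametricRisk {d n : ℕ} (hn : 0 < n)
    (x : Fin n → EuclideanSpace ℝ (Fin d)) (y : Fin n → Fin 2)
    (w l Δ : Fin 2 → ℝ) (hw : ∀ c, 0 < w c)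
    {u : EuclideanSpace ℝ (Fin d)} {γ : ℝ} (hu : ‖u‖ ≤ 1) (hγ : 0 < γ)
    (hmargin : ∀ i, γ ≤ Δ (y i) * (labelSign (y i) * linearModel u (x i)))
    (hunique : ∀ v, ‖v‖ ≤ 1 →
      (∀ i, γ ≤ Δ (y i) * (labelSign (y i) * linearModel v (x i))) → v = u) :
    IsRidgelessSolution (parametricRisk x y w l Δ) u := by
  have hne : (Finset.univ : Finset (Fin n)).Nonempty := ⟨⟨0, hn⟩, Finset.mem_univ _⟩
  have hrisk : parametricRisk x y w l Δ = fun θ => ∑ i, w (y i) *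
      softplus (l (y i) - Δ (y i) * (labelSign (y i) * linearModel θ (x i))) := by
    funext θ
    simp only [parametricRisk, parametricLoss_eq_softplus]
  rw [hrisk]
  refine isRidgelessSolution_of_exponential_bounds (C := ∑ i, w (y i) * Real.exp (l (y i)))
    hu (convexOn_univ_sum fun i => ?_) ?_ hγ ?_
    (fun i v => Δ (y i) * (labelSign (y i) * linearModel v (x i))) (fun i => ?_) hunique ?_
  · simp only [← mul_assoc (Δ _)]
    exact (convexOn_softplus_linearModel _ _ _).smul (hw _).le
  · intro θ τ hτ
    refine Finset.sum_lt_sum_of_nonempty hne fun i _ =>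
      mul_lt_mul_of_pos_left (softplus_strictMono ?_) (hw _)
    rw [linearModel_add, linearModel_smul]
    nlinarith [mul_pos hτ (hγ.trans_le (hmargin i))]
  · intro R hR
    rw [Finset.sum_mul]
    refine Finset.sum_le_sum fun i _ => ?_
    rw [mul_assoc, ← Real.exp_add]
    refine mul_le_mul_of_nonneg_left ((softplus_le_exp _).trans (Real.exp_le_exp.2 ?_)) (hw _).le
    rw [linearModel_smul]
    nlinarith [mul_le_mul_of_nonneg_left (hmargin i) hR.le]
  · exact continuous_const.mul (continuous_const.mul (continuous_linearModel_left _))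
  · intro i δ hδ
    refine ⟨w (y i), hw _, ?_⟩
    -- Once `R * δ ≥ -l`, the slack `δ` absorbs the offset.
    filter_upwards [(tendsto_id.atTop_mul_const hδ).eventually_ge_atTop (-l (y i))] with R hR v _
    simp only [id] at hR
    refine le_trans (mul_le_mul_of_nonneg_left (softplus_strictMono.monotone ?_) (hw _).le)
      (Finset.single_le_sum (f := fun i => w (y i) *
        softplus (l (y i) - Δ (y i) * (labelSign (y i) * linearModel (R • v) (x i))))
        (fun j _ => mul_nonneg (hw _).le (softplus_nonneg _)) (Finset.mem_univ i))
    rw [linearModel_smul]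
    nlinarith

/-! ### The logistic loss under spherical augmentation -/

theorem isProbabilityMeasure_sphericalAugmentation {d : ℕ} (x : EuclideanSpace ℝ (Fin d))
    {r : ℝ} (hr : 0 < r) : IsProbabilityMeasure (sphericalAugmentation x r) :=
  ProbabilityTheory.cond_isProbabilityMeasure_of_finite
    (measure_closedBall_pos _ _ hr).ne' measure_closedBall_lt_top.ne

theorem integrable_sphericalAugmentation {d : ℕ} (x : EuclideanSpace ℝ (Fin d)) {r : ℝ}
    (hr : 0 < r) {f : EuclideanSpace ℝ (Fin d) → ℝ} (hf : Continuous f) :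
    Integrable f (sphericalAugmentation x r) :=
  Integrable.smul_measure (hf.continuousOn.integrableOn_compact (isCompact_closedBall x r))
    (ENNReal.inv_ne_top.2 (measure_closedBall_pos _ _ hr).ne')

theorem ae_mem_sphericalAugmentation {d : ℕ} (x : EuclideanSpace ℝ (Fin d)) (r : ℝ) :
    ∀ᵐ z ∂sphericalAugmentation x r, z ∈ closedBall x r :=
  ProbabilityTheory.ae_cond_mem measurableSet_closedBall

/-- A ball contained in the support has a mass that depends on its radius only. -/
theorem sphericalAugmentation_real_closedBall {d : ℕ} (x c : EuclideanSpace ℝ (Fin d)) {r ρ : ℝ}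
    (hsub : closedBall c ρ ⊆ closedBall x r) :
    (sphericalAugmentation x r).real (closedBall c ρ) =
      (volume.real (closedBall x r))⁻¹ *
        volume.real (closedBall (0 : EuclideanSpace ℝ (Fin d)) ρ) := by
  rw [measureReal_def, sphericalAugmentation,
    ProbabilityTheory.cond_apply measurableSet_closedBall, Set.inter_eq_right.2 hsub,
    Measure.addHaar_closedBall_center volume c, ENNReal.toReal_mul, ENNReal.toReal_inv]
  rfl

theorem continuous_logisticLoss_linearModel {d : ℕ} (c : Fin 2) (θ : EuclideanSpace ℝ (Fin d)) :
    Continuous fun z => logisticLoss c (linearModel θ z) :=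
  continuous_softplus.comp (continuous_const.mul (continuous_linearModel_right θ)).neg

theorem convexOn_integral_logisticLoss {d : ℕ} (c : Fin 2) (x : EuclideanSpace ℝ (Fin d)) {r : ℝ}
    (hr : 0 < r) : ConvexOn ℝ Set.univ
      fun θ => ∫ z, logisticLoss c (linearModel θ z) ∂(sphericalAugmentation x r) := by
  have hint : ∀ θ, Integrable (fun z => logisticLoss c (linearModel θ z))
      (sphericalAugmentation x r) := fun θ =>
    integrable_sphericalAugmentation x hr (continuous_logisticLoss_linearModel c θ)
  refine ⟨convex_univ, fun θ _ θ' _ p q hp hq hpq => ?_⟩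
  simp only [smul_eq_mul]
  rw [← integral_const_mul, ← integral_const_mul,
    ← integral_add ((hint θ).const_mul p) ((hint θ').const_mul q)]
  refine integral_mono (hint _) (((hint θ).const_mul p).add ((hint θ').const_mul q)) fun z => ?_
  have h := (convexOn_softplus_linearModel (labelSign c) 0 z).2 (Set.mem_univ θ)
    (Set.mem_univ θ') hp hq hpq
  simpa [logisticLoss_eq_softplus] using h

/-- Signed predictions vary by at most `r` on the ball of radius `r` around `x`. -/
theorem abs_signed_linearModel_sub_le {d : ℕ} (c : Fin 2) {v x z : EuclideanSpace ℝ (Fin d)} {r : ℝ}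
    (hv : ‖v‖ ≤ 1) (hz : z ∈ closedBall x r) :
    |labelSign c * linearModel v z - labelSign c * linearModel v x| ≤ r := by
  rw [← mul_sub, abs_mul, abs_labelSign, one_mul, linearModel, linearModel, ← inner_sub_right]
  rw [mem_closedBall, dist_eq_norm] at hz
  calc |⟪v, z - x⟫| ≤ ‖v‖ * ‖z - x‖ := abs_real_inner_le_norm _ _
    _ ≤ 1 * r := mul_le_mul hv hz (norm_nonneg _) zero_le_one
    _ = r := one_mul r

/-- A margin above `r` makes `u` classify the whole augmentation ball correctly, so the loss drops
at each of its points. -/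
theorem integral_logisticLoss_lt {d : ℕ} (c : Fin 2) {u x : EuclideanSpace ℝ (Fin d)} {r : ℝ}
    (hr : 0 < r) (hu : ‖u‖ ≤ 1) (hmargin : r < labelSign c * linearModel u x)
    (θ : EuclideanSpace ℝ (Fin d)) {τ : ℝ} (hτ : 0 < τ) :
    ∫ z, logisticLoss c (linearModel (θ + τ • u) z) ∂(sphericalAugmentation x r) <
      ∫ z, logisticLoss c (linearModel θ z) ∂(sphericalAugmentation x r) := by
  have := isProbabilityMeasure_sphericalAugmentation x hr
  have hint : ∀ θ, Integrable (fun z => logisticLoss c (linearModel θ z))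
      (sphericalAugmentation x r) := fun θ =>
    integrable_sphericalAugmentation x hr (continuous_logisticLoss_linearModel c θ)
  have hlt : ∀ᵐ z ∂(sphericalAugmentation x r),
      logisticLoss c (linearModel (θ + τ • u) z) < logisticLoss c (linearModel θ z) := by
    filter_upwards [ae_mem_sphericalAugmentation x r] with z hz
    have h := abs_le.1 (abs_signed_linearModel_sub_le c hu hz)
    refine softplus_strictMono ?_
    rw [linearModel_add, linearModel_smul]
    nlinarith [mul_pos hτ (show 0 < labelSign c * linearModel u z by linarith)]
  refine lt_of_le_of_ne (integral_mono_ae (hint _) (hint _) (hlt.mono fun _ h => h.le)) fun he => ?_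
  rw [integral_eq_iff_of_ae_le (hint _) (hint _) (hlt.mono fun _ h => h.le)] at he
  obtain ⟨z, hz, hz'⟩ := (hlt.and he).exists
  exact hz.ne hz'

theorem integral_logisticLoss_le_exp {d : ℕ} (c : Fin 2) {u x : EuclideanSpace ℝ (Fin d)}
    {r t : ℝ} (hr : 0 < r) (hu : ‖u‖ ≤ 1) (hmargin : r + t ≤ labelSign c * linearModel u x)
    {R : ℝ} (hR : 0 < R) :
    ∫ z, logisticLoss c (linearModel (R • u) z) ∂(sphericalAugmentation x r) ≤
      Real.exp (-(R * t)) := by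
  have := isProbabilityMeasure_sphericalAugmentation x hr
  have hle : ∀ᵐ z ∂(sphericalAugmentation x r),
      logisticLoss c (linearModel (R • u) z) ≤ Real.exp (-(R * t)) := by
    filter_upwards [ae_mem_sphericalAugmentation x r] with z hz
    have h := abs_le.1 (abs_signed_linearModel_sub_le c hu hz)
    refine (softplus_le_exp _).trans (Real.exp_le_exp.2 ?_)
    rw [linearModel_smul]
    nlinarith [mul_le_mul_of_nonneg_left
      (show t ≤ labelSign c * linearModel u z by linarith) hR.le]
  refine (integral_mono_ae (integrable_sphericalAugmentation x hr
    (continuous_logisticLoss_linearModel c _)) (integrable_const _) hle).trans ?_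
  simp

/-- The points of the augmentation ball whose signed prediction is within `δ` of the robust margin
have a probability bounded below uniformly over unit directions. -/
theorem exists_pos_mul_softplus_le_integral {d : ℕ} (c : Fin 2) (x : EuclideanSpace ℝ (Fin d))
    {r δ : ℝ} (hr : 0 < r) (hδ : 0 < δ) :
    ∃ p : ℝ, 0 < p ∧ ∀ R : ℝ, 0 < R → ∀ v : EuclideanSpace ℝ (Fin d), ‖v‖ = 1 →
      p * softplus (-(R * (labelSign c * linearModel v x - r + δ))) ≤
        ∫ z, logisticLoss c (linearModel (R • v) z) ∂(sphericalAugmentation x r) := by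
  have := isProbabilityMeasure_sphericalAugmentation x hr
  set ρ : ℝ := min δ r / 2 with hρ
  have hρ0 : 0 < ρ := by have := lt_min hδ hr; positivity
  have hρδ : 2 * ρ ≤ δ := by linarith [min_le_left δ r]
  have hρr : 2 * ρ ≤ r := by linarith [min_le_right δ r]
  have hvol : ∀ (z : EuclideanSpace ℝ (Fin d)) {s : ℝ}, 0 < s →
      0 < volume.real (closedBall z s) := fun z s hs =>
    ENNReal.toReal_pos (measure_closedBall_pos _ _ hs).ne' measure_closedBall_lt_top.ne
  refine ⟨_, mul_pos (inv_pos.2 (hvol x hr)) (hvol 0 hρ0), fun R hR v hv => ?_⟩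
  -- Moving from `x` by `r - ρ` against the signed direction leaves room for a ball of radius `ρ`,
  -- on which the signed prediction is at most its value at `x` minus `r - 2ρ`, and `2ρ ≤ δ`.
  set b : EuclideanSpace ℝ (Fin d) := x - (labelSign c * (r - ρ)) • v with hb
  have hsub : closedBall b ρ ⊆ closedBall x r := by
    refine closedBall_subset_closedBall' ?_
    rw [hb, dist_eq_norm, sub_sub_cancel_left, norm_neg, norm_smul, hv, mul_one, Real.norm_eq_abs,
      abs_mul, abs_labelSign, one_mul, abs_of_nonneg (by linarith)]
    linarith
  have hbval : labelSign c * linearModel v b = labelSign c * linearModel v x - (r - ρ) := by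
    have hvv : ⟪v, v⟫ = 1 := by rw [real_inner_self_eq_norm_sq, hv, one_pow]
    rw [hb, linearModel, linearModel, inner_sub_right, real_inner_smul_right, hvv]
    linear_combination (-(r - ρ)) * labelSign_mul_self c
  have hint := integrable_sphericalAugmentation x hr (continuous_logisticLoss_linearModel c (R • v))
  rw [← sphericalAugmentation_real_closedBall x b hsub]
  calc (sphericalAugmentation x r).real (closedBall b ρ) *
        softplus (-(R * (labelSign c * linearModel v x - r + δ)))
      = ∫ _ in closedBall b ρ, softplus (-(R * (labelSign c * linearModel v x - r + δ)))
          ∂(sphericalAugmentation x r) := by rw [setIntegral_const, smul_eq_mul]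
    _ ≤ ∫ z in closedBall b ρ, logisticLoss c (linearModel (R • v) z)
          ∂(sphericalAugmentation x r) := by
        refine setIntegral_mono_on (integrable_const _).integrableOn hint.integrableOn
          measurableSet_closedBall fun z hz => softplus_strictMono.monotone ?_
        have h := abs_le.1 (abs_signed_linearModel_sub_le c hv.le hz)
        rw [linearModel_smul]
        nlinarith [mul_le_mul_of_nonneg_left
          (show labelSign c * linearModel v z ≤ labelSign c * linearModel v x - r + δ by linarith)
          hR.le]
    _ ≤ _ := setIntegral_le_integral hint (Eventually.of_forall fun z => softplus_nonneg _)

theorem isRidgelessSolution_augmentedLogisticRisk {d n : ℕ} (hn : 0 < n)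
    (x : Fin n → EuclideanSpace ℝ (Fin d)) (y : Fin n → Fin 2)
    (ε : Fin 2 → ℝ) (hε : ∀ c, 0 < ε c)
    {u : EuclideanSpace ℝ (Fin d)} {t : ℝ} (hu : ‖u‖ ≤ 1) (ht : 0 < t)
    (hmargin : ∀ i, ε (y i) + t ≤ labelSign (y i) * linearModel u (x i))
    (hunique : ∀ v, ‖v‖ ≤ 1 →
      (∀ i, ε (y i) + t ≤ labelSign (y i) * linearModel v (x i)) → v = u) :
    IsRidgelessSolution (augmentedLogisticRisk x y ε) u := by
  have hne : (Finset.univ : Finset (Fin n)).Nonempty := ⟨⟨0, hn⟩, Finset.mem_univ _⟩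
  refine isRidgelessSolution_of_exponential_bounds (C := n) hu
    (convexOn_univ_sum fun i => convexOn_integral_logisticLoss _ _ (hε _)) ?_ ht ?_
    (fun i v => labelSign (y i) * linearModel v (x i) - ε (y i)) (fun i => ?_)
    (fun v hv h => hunique v hv fun i => by linarith [h i]) ?_
  · intro θ τ hτ
    exact Finset.sum_lt_sum_of_nonempty hne fun i _ =>
      integral_logisticLoss_lt _ (hε _) hu (by linarith [hmargin i]) θ hτ
  · intro R hR
    refine (Finset.sum_le_sum fun i _ =>
      integral_logisticLoss_le_exp _ (hε _) hu (hmargin i) hR).trans ?_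
    simp
  · exact (continuous_const.mul (continuous_linearModel_left _)).sub continuous_const
  · intro i δ hδ
    obtain ⟨p, hp, h⟩ := exists_pos_mul_softplus_le_integral (y i) (x i) (hε (y i)) hδ
    refine ⟨p, hp, ?_⟩
    filter_upwards [eventually_gt_atTop 0] with R hR v hv
    exact (h R hR v hv).trans (Finset.single_le_sum (f := fun i =>
      ∫ z, logisticLoss (y i) (linearModel (R • v) z) ∂(sphericalAugmentation (x i) (ε (y i))))
      (fun j _ => integral_nonneg fun z => softplus_nonneg _) (Finset.mem_univ i))

/-! ### Matching the radii to the scales -/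

theorem lemma2 {d n : ℕ} (hn : 0 < n)
    (x : Fin n → EuclideanSpace ℝ (Fin d)) (y : Fin n → Fin 2)
    (hsep : LinearlySeparable x y)
    (w l Δ : Fin 2 → ℝ) (hw : ∀ c, 0 < w c) (hΔ : ∀ c, 0 < Δ c) :
    ∃ ε : Fin 2 → ℝ, (∀ c, 0 < ε c) ∧
      ∃ u : EuclideanSpace ℝ (Fin d), ‖u‖ = 1 ∧
        IsRidgelessSolution (parametricRisk x y w l Δ) u ∧
        IsRidgelessSolution (augmentedLogisticRisk x y ε) u := by
  obtain ⟨u, γ, hu, hγ, hmargin, hunique⟩ := exists_unique_max_margin hn x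
    (fun i => Δ (y i) * labelSign (y i)) (hsep.imp fun θ hθ i => by
      rw [mul_assoc]
      exact mul_pos (hΔ _) (hθ i))
  simp only [mul_assoc] at hmargin hunique
  have hpos : ∀ c, 0 < γ / Δ c := fun c => div_pos hγ (hΔ c)
  have ht : 0 < min (γ / Δ 0) (γ / Δ 1) := lt_min (hpos 0) (hpos 1)
  -- Halving the minimum keeps both `t` and each radius `γ / Δ c - t` positive.
  set t : ℝ := min (γ / Δ 0) (γ / Δ 1) / 2 with ht_def
  have hle : ∀ c, 2 * t ≤ γ / Δ c := by
    rw [Fin.forall_fin_two]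
    constructor
    · linarith [min_le_left (γ / Δ 0) (γ / Δ 1)]
    · linarith [min_le_right (γ / Δ 0) (γ / Δ 1)]
  have hiff : ∀ (c : Fin 2) (m : ℝ), γ / Δ c - t + t ≤ m ↔ γ ≤ Δ c * m := by
    intro c m
    rw [sub_add_cancel, div_le_iff₀' (hΔ c)]
  have hε : ∀ c, 0 < γ / Δ c - t := fun c => by linarith [hle c]
  refine ⟨fun c => γ / Δ c - t, hε, u, hu,
    isRidgelessSolution_parametricRisk hn x y w l Δ hw hu.le hγ hmargin hunique,
    isRidgelessSolution_augmentedLogisticRisk hn x y _ hε hu.le (half_pos ht) ?_ ?_⟩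
  · exact fun i => (hiff _ _).2 (hmargin i)
  · exact fun v hv h => hunique v hv fun i => (hiff _ _).1 (h i)
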